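/- Let $f:\mathbb{R}^{n}\times\mathbb{R}^{m}\to\mathbb{R}^{n}$ be $C^1$, let $\Omega\subset\mathbb{R}^{m}$ be compact, $\chi_i\in\mathbb{R}^n$, and $T\in\mathbb{R}$. For $s\in[0,T]$, an admissible control on $[0,s]$ is a measurable function $u$ with $u(t)\in\Omega$ for all $t\in[0,s]$, and its response is the absolutely continuous solution $\chi$ on $[0,s]$ (when it exists) of $\dot\chi=f(\chi,u)$ for a.e. $t$, $\chi(0)=\chi_i$. Assume that - there is a constant $M$ such that $|\chi(t)|<M$ for every $s\in[0,T]$, every response $\chi$ on $[0,s]$ and every $t\in[0,s]$; - for each $\chi\in\mathbb{R}^n$ the set $V(\chi)=\{f(\chi,u):u\in\Omega\}$ is convex. Put $\mathcal H(\chi,p,u)=p^{T}f(\chi,u)$, $U(\chi,p)=\operatorname{arg\,max}_{u\in\Omega}\mathcal H(\chi,p,u)$, and $$F(\chi,p)=\left\{\begin{bmatrix} f(\chi,u)\\ -\left(\frac{\partial f}{\partial\chi}(\chi,u)\right)^{T}p\end{bmatrix} : u\in U(\chi,p)\right\}\subset\mathbb{R}^{2n}.$$ For $t_f\in[0,T]$,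 let $S(f,t_f,\chi_i)$ be the set of triples $(\chi,p,u)$ on $[0,t_f]$ such that $u$ is an admissible control, $\chi$ is its response, $p$ is absolutely continuous and not identically zero on $[0,t_f]$, $\dot p=-\left(\frac{\partial f}{\partial\chi}(\chi,u)\right)^{T}p$ for a.e. $t$, and $u(t)\in U(\chi(t),p(t))$ for a.e. $t\in[0,t_f]$. An extremal on $[0,t_f]$ is a function $\chi$ that belongs to some triple $(\chi,p,u)\in S(f,t_f,\chi_i)$, and $E(f,t_f,\chi_i)=\{\chi(t_f):(\chi,p,u)\in S(f,t_f,\chi_i)\}$. If $F(\chi,p)$ is convex for all $(\chi,p)\in\mathbb{R}^n\times\mathbb{R}^n$, then for every $t_f\in[0,T]$: - every extremal $\chi$ on $[0,t_f]$ is extendable, that is, there is an extremal $\chi'$ on $[0,T]$ with $\chi'(t)=\chi(t)$ for all $t\in[0,t_f]$; - every sequence of extremals on $[0,t_f]$ has a subsequence that converges uniformly on $[0,t_f]$ to an extremal on $[0,t_f]$; - $E(f,t_f,\chi_i)$ is compact. -/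

import Mathlib

open MeasureTheory Set Filter Topology

noncomputable section

namespace PMP

/-- `ℝⁿ` with its Euclidean norm and inner product. -/
abbrev Vec (n : ℕ) : Type := EuclideanSpace ℝ (Fin n)

variable {n m : ℕ}

/-- Admissible controls on `[0, s]`: Lebesgue measurable functions with values in the restraint
set `Ω`. (For the restriction of Lebesgue measure, `AEMeasurable` is Lebesgue measurability.) -/
def IsControl (Ω : Set (Vec m)) (s : ℝ) (u : ℝ → Vec m) : Prop :=
  AEMeasurable u (volume.restrict (Icc 0 s)) ∧ ∀ t ∈ Icc 0 s, u t ∈ Ω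

/-- `y` is an absolutely continuous (Carathéodory) solution of `ẏ = g` on `[0, s]` with
`y 0 = y₀`, written in integral form. -/
def IsCaratheodorySolution (s : ℝ) (y₀ : Vec n) (g : ℝ → Vec n) (y : ℝ → Vec n) : Prop :=
  ContinuousOn y (Icc 0 s) ∧ IntervalIntegrable g volume 0 s ∧
    ∀ t ∈ Icc 0 s, y t = y₀ + ∫ τ in (0 : ℝ)..t, g τ

/-- `χ` is the response (trajectory) on `[0, s]` of `χ̇ = f(χ, u)`, `χ(0) = χi`, to the admissible
control `u`. -/
def IsResponse (f : Vec n → Vec m → Vec n) (Ω : Set (Vec m)) (χi : Vec n) (s : ℝ)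
    (χ : ℝ → Vec n) (u : ℝ → Vec m) : Prop :=
  IsControl Ω s u ∧ IsCaratheodorySolution s χi (fun τ => f (χ τ) (u τ)) χ

/-- All responses that start at `χi` obey one bound `M`, which depends neither on the control nor
on the time. Responses on every initial segment `[0, s]` of `[0, T]` are meant, so that
a response cannot escape to infinity before the time `T`. -/
def UniformlyBoundedResponses (f : Vec n → Vec m → Vec n) (Ω : Set (Vec m)) (χi : Vec n)
    (T : ℝ) : Prop :=
  ∃ M : ℝ, ∀ s ∈ Icc 0 T, ∀ (χ : ℝ → Vec n) (u : ℝ → Vec m),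
    IsResponse f Ω χi s χ u → ∀ t ∈ Icc 0 s, ‖χ t‖ < M

/-- The set `V(χ) = {f(χ, u) : u ∈ Ω}` of velocities at `χ`. -/
def velocitySet (f : Vec n → Vec m → Vec n) (Ω : Set (Vec m)) (χ : Vec n) : Set (Vec n) :=
  {v | ∃ u ∈ Ω, v = f χ u}

/-- The Hamiltonian `H(χ, p, u) = pᵀ f(χ, u)`. -/
def hamiltonian (f : Vec n → Vec m → Vec n) (χ p : Vec n) (u : Vec m) : ℝ :=
  inner ℝ p (f χ u)

/-- The set `U(χ, p)` of the maximizers over `Ω` of `u ↦ H(χ, p, u)`. -/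
def maximizers (f : Vec n → Vec m → Vec n) (Ω : Set (Vec m)) (χ p : Vec n) : Set (Vec m) :=
  {u | u ∈ Ω ∧ ∀ v ∈ Ω, hamiltonian f χ p v ≤ hamiltonian f χ p u}

/-- The right-hand side `-(∂f/∂χ)(χ, u)ᵀ p` of the adjoint equation. -/
def adjointField (f : Vec n → Vec m → Vec n) (χ p : Vec n) (u : Vec m) : Vec n :=
  -(ContinuousLinearMap.adjoint (fderiv ℝ (fun x => f x u) χ)) p

/-- The set `F(χ, p)` of the velocities of state and costate under Hamiltonian-maximizing
controls. -/
def extremalVelocities (f : Vec n → Vec m → Vec n) (Ω : Set (Vec m)) (χ p : Vec n) :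
    Set (Vec n × Vec n) :=
  {w | ∃ u ∈ maximizers f Ω χ p, w = (f χ u, adjointField f χ p u)}

/-- The set `S(f, s, χi)` of triples `(χ, p, u)` where `χ` is the response to `u` on `[0, s]`,
`p` is a solution on `[0, s]` of the adjoint equation that does not vanish identically, and `u`
maximizes the Hamiltonian at almost all times. -/
def extremalTriples (f : Vec n → Vec m → Vec n) (Ω : Set (Vec m)) (χi : Vec n) (s : ℝ) :
    Set ((ℝ → Vec n) × (ℝ → Vec n) × (ℝ → Vec m)) :=
  {z | IsResponse f Ω χi s z.1 z.2.2 ∧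
    IsCaratheodorySolution s (z.2.1 0) (fun τ => adjointField f (z.1 τ) (z.2.1 τ) (z.2.2 τ))
      z.2.1 ∧
    (∃ t ∈ Icc 0 s, z.2.1 t ≠ 0) ∧
    ∀ᵐ t ∂(volume.restrict (Icc 0 s)), z.2.2 t ∈ maximizers f Ω (z.1 t) (z.2.1 t)}

/-- `χ` is an extremal trajectory on `[0, s]`. -/
def IsExtremal (f : Vec n → Vec m → Vec n) (Ω : Set (Vec m)) (χi : Vec n) (s : ℝ)
    (χ : ℝ → Vec n) : Prop :=
  ∃ (p : ℝ → Vec n) (u : ℝ → Vec m), (χ, p, u) ∈ extremalTriples f Ω χi s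

/-- `χ`, given on `[0, s]`, agrees there with an extremal trajectory on `[0, T]`. -/
def IsExtendable (f : Vec n → Vec m → Vec n) (Ω : Set (Vec m)) (χi : Vec n) (T s : ℝ)
    (χ : ℝ → Vec n) : Prop :=
  ∃ χ' : ℝ → Vec n, IsExtremal f Ω χi T χ' ∧ ∀ t ∈ Icc 0 s, χ t = χ' t

/-- The set `E(f, s, χi)` of the endpoints at time `s` of the extremals on `[0, s]`. -/
def extremalEndpoints (f : Vec n → Vec m → Vec n) (Ω : Set (Vec m)) (χi : Vec n) (s : ℝ) :
    Set (Vec n) :=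
  {x | ∃ z ∈ extremalTriples f Ω χi s, x = z.1 s}

end PMP

end

/-!
Extremals are treated as solutions `z = (χ, p)` of the autonomous differential inclusion
`ż ∈ F(z)`. By the maximum theorem, compactness of `Ω` and continuity of `f` and `∂f/∂χ` make `F`
an upper semicontinuous set-valued map with compact values, nonempty as soon as `Ω` is, and by
hypothesis the values are convex.

* Closure and compactness (`exists_subseq_tendstoUniformlyOn_inclusionSolution`). Uniformly Lipschitz
  approximate solutions have a uniformly convergent subsequence by Arzelà–Ascoli. At a point of
  differentiability of the limit, difference quotients of the approximations are averages of
  velocities lying in a closed convex neighbourhood of `F(z t)`, so the derivative of the limit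
  lies in every such neighbourhood, hence in `F(z t)`. No weak compactness in `L¹` is needed.
* Existence (`exists_inclusionSolution`). Euler polygons are approximate solutions, so a bounded
  inclusion is solvable on any interval.
* Recovering the control (`exists_control_of_isInclusionSolution`). A Borel selection of a closed
  relation with values in a compact set (`exists_measurable_selection`) turns a solution of the
  inclusion into a triple `(χ, p, u)`. The selection is obtained by parametrizing the compact set by
  the Cantor set and taking the least admissible parameter, which is lower semicontinuous.

For the compactness of the set of extremals, Gronwall's inequality shows that `p 0 ≠ 0`; since the
conditions on `p` are positively homogeneous, one may take `‖p 0‖ = 1`. Gronwall's inequality then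
bounds `p`, and the limit of the costates still has norm one at time `0`.

For extendability, the inclusion is continued past `tf` with `F` replaced by its composition with
radial retractions of the state onto the ball of radius `M` and of the costate onto a large ball.
Gronwall's inequality keeps the costate inside its ball. Up to the first time at which the state
would reach norm `M` the solution is a genuine response, whose norm is less than `M` by
hypothesis; so that time never comes, and the truncation is never active.
-/

noncomputable section

namespace PMP

/-! ### Gronwall's inequality, Lipschitz curves, measurable selection and compactness -/

/-- Gronwall's inequality in integral form, for a function continuous on `[0, s]`. -/
theorem le_mul_exp_of_le_add_integral {φ : ℝ → ℝ} {a L s : ℝ} (hL : 0 ≤ L)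
    (hφ : ContinuousOn φ (Icc 0 s)) (h : ∀ t ∈ Icc 0 s, φ t ≤ a + L * ∫ τ in (0 : ℝ)..t, φ τ) :
    ∀ t ∈ Icc 0 s, φ t ≤ a * Real.exp (L * t) := by
  intro t ht
  have hs : 0 ≤ s := ht.1.trans ht.2
  set ψ : ℝ → ℝ := IccExtend hs ((Icc 0 s).domRestrict φ) with hψ
  have hψc : Continuous ψ := (continuousOn_iff_continuous_domRestrict.1 hφ).Icc_extend'
  have hψφ : ∀ τ ∈ Icc 0 s, ψ τ = φ τ := fun τ hτ => by
    rw [hψ, IccExtend_of_mem _ _ hτ]; rfl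
  have hint : ∀ τ ∈ Icc 0 s, ∫ r in (0 : ℝ)..τ, φ r = ∫ r in (0 : ℝ)..τ, ψ r := fun τ hτ =>
    intervalIntegral.integral_congr fun r hr => by
      rw [uIcc_of_le hτ.1] at hr
      exact (hψφ r ⟨hr.1, hr.2.trans hτ.2⟩).symm
  set q : ℝ → ℝ := fun τ => a + L * ∫ r in (0 : ℝ)..τ, ψ r with hq
  have hqd : ∀ τ, HasDerivAt q (L * ψ τ) τ := fun τ =>
    ((hψc.integral_hasStrictDerivAt 0 τ).hasDerivAt.const_mul L).const_add a
  have hed : ∀ τ, HasDerivAt (fun τ => Real.exp (-(L * τ))) (Real.exp (-(L * τ)) * -L) τ := by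
    intro τ
    have := (((hasDerivAt_id τ).const_mul L).neg).exp
    simpa using this
  have hd : ∀ τ, HasDerivAt (fun τ => Real.exp (-(L * τ)) * q τ)
      (Real.exp (-(L * τ)) * -L * q τ + Real.exp (-(L * τ)) * (L * ψ τ)) τ :=
    fun τ => (hed τ).mul (hqd τ)
  have hψq : ∀ τ ∈ Icc 0 s, ψ τ ≤ q τ := fun τ hτ => by
    rw [hψφ τ hτ, hq]; simpa only [hint τ hτ] using h τ hτ
  have hanti : AntitoneOn (fun τ => Real.exp (-(L * τ)) * q τ) (Icc 0 s) := by
    refine antitoneOn_of_deriv_nonpos (convex_Icc 0 s)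
      (fun τ _ => (hd τ).continuousAt.continuousWithinAt)
      (fun τ _ => (hd τ).differentiableAt.differentiableWithinAt) fun τ hτ => ?_
    rw [interior_Icc] at hτ
    rw [(hd τ).deriv]
    have h1 : 0 ≤ Real.exp (-(L * τ)) * L := by positivity
    nlinarith [mul_le_mul_of_nonneg_left (hψq τ (Ioo_subset_Icc_self hτ)) h1]
  have h0 := hanti ⟨le_rfl, hs⟩ ht ht.1
  have hq0 : q 0 = a := by simp [hq]
  simp only [mul_zero, neg_zero, Real.exp_zero, one_mul, hq0] at h0
  calc φ t = ψ t := (hψφ t ht).symm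
    _ ≤ q t := hψq t ht
    _ = Real.exp (-(L * t)) * q t * Real.exp (L * t) := by
        rw [mul_right_comm, ← Real.exp_add]; simp
    _ ≤ a * Real.exp (L * t) := by gcongr

/-- The fundamental theorem of calculus for a Lipschitz curve in a finite-dimensional space. It is
reduced to the scalar case by testing against continuous linear functionals. -/
theorem _root_.LipschitzWith.intervalIntegrable_deriv_and_integral_deriv {E : Type*}
    [NormedAddCommGroup E] [NormedSpace ℝ E] [FiniteDimensional ℝ E] {C : NNReal} {z : ℝ → E}
    (hz : LipschitzWith C z) (a b : ℝ) :
    IntervalIntegrable (deriv z) volume a b ∧ ∫ τ in a..b, deriv z τ = z b - z a := by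
  have := FiniteDimensional.complete ℝ E
  have : ∀ x y, IntervalIntegrable (deriv z) volume x y := fun x y => by
    refine (intervalIntegrable_const (c := (C : ℝ))).mono_fun
      (aestronglyMeasurable_deriv z _) (ae_of_all _ fun t => ?_)
    simpa using norm_deriv_le_of_lipschitz hz (x₀ := t)
  refine ⟨this a b, ?_⟩
  refine (SeparatingDual.eq_iff_forall_dual_eq (R := ℝ)).2 fun ℓ => ?_
  rw [← ℓ.intervalIntegral_comp_comm (this a b), map_sub]
  have hAC : AbsolutelyContinuousOnInterval (fun t => ℓ (z t)) a b :=
    ((ℓ.lipschitz.comp hz).lipschitzOnWith (s := uIcc a b)).absolutelyContinuousOnInterval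
  rw [← hAC.integral_deriv_eq_sub]
  refine intervalIntegral.integral_congr_ae ?_
  filter_upwards [hz.ae_differentiableAt_real] with t ht _
  exact ((ℓ.hasFDerivAt.comp_hasDerivAt t ht.hasDerivAt).deriv).symm

/-- A closed relation between points of `Y` and points of a compact set `Ω` has a Borel selection.
Write `Ω` as a continuous image of the Cantor set, which is totally ordered and compact, and choose
the least parameter whose image is related to `y`. -/
theorem exists_measurable_selection {Y W : Type*} [TopologicalSpace Y]
    [MeasurableSpace Y] [BorelSpace Y] [MetricSpace W] [MeasurableSpace W] [BorelSpace W]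
    {Ω : Set W} (hΩ : IsCompact Ω) (hne : Ω.Nonempty) {R : Set (Y × W)} (hR : IsClosed R) :
    ∃ σ : Y → W, Measurable σ ∧ (∀ y, σ y ∈ Ω) ∧ ∀ y, (∃ w ∈ Ω, (y, w) ∈ R) → (y, σ y) ∈ R := by
  classical
  have := isCompact_iff_compactSpace.1 hΩ
  have := hne.to_subtype
  obtain ⟨c₀, hc₀, hc₀s⟩ := exists_nat_bool_continuous_surjective_of_compact Ω
  set c : cantorSet → Ω := c₀ ∘ cantorSetHomeomorphNatToBool with hcdef
  have hc : Continuous c := hc₀.comp cantorSetHomeomorphNatToBool.continuous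
  have hcs : Function.Surjective c := hc₀s.comp cantorSetHomeomorphNatToBool.surjective
  have := isCompact_iff_compactSpace.1 isCompact_cantorSet
  -- the fibre over `y`, as a subset of the Cantor set
  set A : Y → Set cantorSet := fun y => {θ | (y, (c θ : W)) ∈ R} with hA
  have hRc : IsClosed {q : Y × cantorSet | (q.1, (c q.2 : W)) ∈ R} :=
    hR.preimage (by fun_prop)
  have hAcl : ∀ y, IsClosed (A y) := fun y =>
    hRc.preimage (by fun_prop : Continuous fun θ : cantorSet => (y, θ))
  have hmin : ∀ y, ∃ θ : cantorSet, (A y).Nonempty → IsLeast (A y) θ := fun y => by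
    by_cases h : (A y).Nonempty
    · obtain ⟨θ, hθ⟩ := (hAcl y).isCompact.exists_isLeast h
      exact ⟨θ, fun _ => hθ⟩
    · exact ⟨⟨0, zero_mem_cantorSet⟩, fun h' => absurd h' h⟩
  set D : Set Y := {y | (A y).Nonempty} with hD
  -- the sublevel sets of the least parameter are projections of closed sets along a compact space
  have hproj : ∀ a : ℝ, IsClosed {y | ∃ θ ∈ A y, (θ : ℝ) ≤ a} := fun a => by
    have h1 : IsClosed ({q : Y × cantorSet | (q.1, (c q.2 : W)) ∈ R} ∩ {q | (q.2 : ℝ) ≤ a}) :=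
      hRc.inter (isClosed_le (by fun_prop) continuous_const)
    convert isClosedMap_fst_of_compactSpace _ h1 using 1
    ext y
    constructor
    · rintro ⟨θ, h, h'⟩
      exact ⟨(y, θ), ⟨h, h'⟩, rfl⟩
    · rintro ⟨⟨y', θ⟩, ⟨h, h'⟩, rfl⟩
      exact ⟨θ, h, h'⟩
  have hDcl : IsClosed D := by
    convert isClosedMap_fst_of_compactSpace _ hRc using 1
    ext y
    constructor
    · rintro ⟨θ, h⟩
      exact ⟨(y, θ), h, rfl⟩
    · rintro ⟨⟨y', θ⟩, h, rfl⟩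
      exact ⟨θ, h⟩
  choose m hm using hmin
  set σ : Y → cantorSet := D.piecewise m fun _ => ⟨0, zero_mem_cantorSet⟩ with hσ
  have hσm : Measurable σ := by
    refine (MeasurableEmbedding.subtype_coe isClosed_cantorSet.measurableSet).measurable_comp_iff.1
      (measurable_of_Iic fun a => ?_)
    have : (Subtype.val ∘ σ) ⁻¹' Iic a = {y | ∃ θ ∈ A y, (θ : ℝ) ≤ a} ∪
        (Dᶜ ∩ {_y | (0 : ℝ) ≤ a}) := by
      ext y
      by_cases hy : y ∈ D
      · have hl := hm y hy
        simp only [mem_preimage, Function.comp_apply, hσ,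
          Set.piecewise_eq_of_mem _ _ _ hy, mem_Iic, mem_union,
          mem_ofPred_eq, mem_inter_iff, mem_compl_iff, hy, not_true_eq_false, false_and, or_false]
        exact ⟨fun h => ⟨_, hl.1, h⟩, fun ⟨θ, h, h'⟩ => (Subtype.coe_le_coe.2 (hl.2 h)).trans h'⟩
      · have : ¬ ∃ θ ∈ A y, (θ : ℝ) ≤ a := fun ⟨θ, h, _⟩ => hy ⟨θ, h⟩
        simp only [mem_preimage, Function.comp_apply, hσ,
          Set.piecewise_eq_of_notMem _ _ _ hy, mem_Iic, mem_union,
          mem_ofPred_eq, this, mem_inter_iff, mem_compl_iff, hy, not_false_eq_true, true_and,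
          false_or]
    rw [this]
    exact (hproj a).measurableSet.union (hDcl.measurableSet.compl.inter (.const _))
  refine ⟨fun y => (c (σ y) : W), measurable_subtype_coe.comp (hc.measurable.comp hσm),
    fun y => (c _).2, ?_⟩
  rintro y ⟨w, hw, hyw⟩
  obtain ⟨θ, hθ⟩ := hcs ⟨w, hw⟩
  have hy : y ∈ D := ⟨θ, by simpa [hA, hθ] using hyw⟩
  simp only [hσ, Set.piecewise_eq_of_mem _ _ _ hy]
  exact (hm y hy).1

/-- The Arzelà–Ascoli theorem for curves on `[0, s]` with a common Lipschitz constant. The limit is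
extended by constants, so as to be Lipschitz on all of `ℝ`. -/
theorem exists_subseq_tendstoUniformlyOn_of_lipschitzOnWith {E : Type*}
    [NormedAddCommGroup E] [NormedSpace ℝ E] [FiniteDimensional ℝ E] {C : NNReal} {s r : ℝ}
    (hs : 0 ≤ s) {z : ℕ → ℝ → E} (hz : ∀ k, LipschitzOnWith C (z k) (Icc 0 s))
    (h0 : ∀ k, ‖z k 0‖ ≤ r) :
    ∃ (φ : ℕ → ℕ) (y : ℝ → E), StrictMono φ ∧ LipschitzWith C y ∧
      TendstoUniformlyOn (fun k => z (φ k)) y atTop (Icc 0 s) := by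
  have := FiniteDimensional.proper ℝ E
  have hLip : ∀ k, LipschitzWith C ((Icc 0 s).domRestrict (z k)) := fun k =>
    lipschitzOnWith_iff_restrict.1 (hz k)
  set Z : ℕ → BoundedContinuousFunction (Icc (0 : ℝ) s) E := fun k =>
    BoundedContinuousFunction.mkOfCompact ⟨(Icc 0 s).domRestrict (z k), (hLip k).continuous⟩ with hZ
  have hZa : ∀ k t, Z k t = z k t := fun k t => rfl
  have hcpt : IsCompact (closure (range Z)) := by
    refine BoundedContinuousFunction.arzela_ascoli (Metric.closedBall 0 (r + C * s))
      (isCompact_closedBall _ _) _ ?_ ?_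
    · rintro _ t ⟨k, rfl⟩
      have h1 := (hz k).dist_le_mul t.1 t.2 0 ⟨le_rfl, hs⟩
      rw [mem_closedBall_zero_iff, hZa]
      have h2 : dist t.1 0 ≤ s := by
        rw [Real.dist_eq, sub_zero, abs_of_nonneg t.2.1]; exact t.2.2
      calc ‖z k t‖ ≤ ‖z k 0‖ + dist (z k t) (z k 0) := by
            rw [dist_eq_norm]; simpa using norm_add_le (z k 0) (z k t - z k 0)
        _ ≤ r + C * s := add_le_add (h0 k) (h1.trans (by gcongr))
    · refine (LipschitzWith.uniformEquicontinuous _ C ?_).equicontinuous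
      rintro ⟨_, k, rfl⟩
      exact hLip k
  obtain ⟨Y, -, φ, hφ, hlim⟩ := hcpt.tendsto_subseq fun k => subset_closure (mem_range_self k)
  have hunif := BoundedContinuousFunction.tendsto_iff_tendstoUniformly.1 hlim
  have hYL : LipschitzWith C Y := by
    refine LipschitzWith.of_dist_le_mul fun t t' => ?_
    refine le_of_tendsto ((hunif.tendsto_at t).dist (hunif.tendsto_at t'))
      (Eventually.of_forall fun k => (hLip (φ k)).dist_le_mul t t')
  refine ⟨φ, IccExtend hs Y, hφ, ?_, ?_⟩
  · rw [← mul_one C]; exact hYL.comp (LipschitzWith.projIcc hs)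
  · rw [Metric.tendstoUniformlyOn_iff]
    intro ε hε
    filter_upwards [Metric.tendstoUniformly_iff.1 hunif ε hε] with k hk t ht
    rw [IccExtend_of_mem _ _ ht]
    exact hk ⟨t, ht⟩

/-! ### Differential inclusions -/

section Inclusion

variable {E : Type*} [NormedAddCommGroup E] [NormedSpace ℝ E]

/-- Upper semicontinuity (in the `ε`-sense) of the set-valued map `G`: near `e` the values are
contained in closed thickenings of `G e`. -/
def IsUpperSemicontinuousMap (G : E → Set E) : Prop :=
  ∀ e, ∀ ε > 0, ∀ᶠ e' in 𝓝 e, G e' ⊆ Metric.cthickening ε (G e)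

/-- On `[0, s]`, `z` is absolutely continuous with derivative `v`, in integral form. -/
def IsPrimitiveOn (s : ℝ) (v z : ℝ → E) : Prop :=
  IntervalIntegrable v volume 0 s ∧ ∀ t ∈ Icc 0 s, z t = z 0 + ∫ τ in (0 : ℝ)..t, v τ

/-- `z` is an absolutely continuous solution on `[0, s]` of the differential inclusion
`ż ∈ G(z)`. -/
def IsInclusionSolution (G : E → Set E) (s : ℝ) (z : ℝ → E) : Prop :=
  ∃ v, IsPrimitiveOn s v z ∧ ∀ᵐ t ∂(volume.restrict (Icc 0 s)), v t ∈ G (z t)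

namespace IsPrimitiveOn

variable {s : ℝ} {v z : ℝ → E}

theorem intervalIntegrable (h : IsPrimitiveOn s v z) {a b : ℝ} (ha : a ∈ Icc 0 s)
    (hb : b ∈ Icc 0 s) : IntervalIntegrable v volume a b := by
  refine h.1.mono_set ?_
  rw [uIcc_of_le (ha.1.trans ha.2)]
  exact uIcc_subset_Icc ha hb

theorem sub_eq (h : IsPrimitiveOn s v z) {a b : ℝ} (ha : a ∈ Icc 0 s) (hb : b ∈ Icc 0 s) :
    z b - z a = ∫ τ in a..b, v τ := by
  have h0 : (0 : ℝ) ∈ Icc 0 s := ⟨le_rfl, ha.1.trans ha.2⟩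
  rw [h.2 a ha, h.2 b hb, add_sub_add_left_eq_sub,
    intervalIntegral.integral_interval_sub_left (h.intervalIntegrable h0 hb)
      (h.intervalIntegrable h0 ha)]

theorem continuousOn (h : IsPrimitiveOn s v z) : ContinuousOn z (Icc 0 s) := by
  rcases lt_or_ge s 0 with hs | hs
  · simp [Icc_eq_empty_of_lt hs]
  have h1 := intervalIntegral.continuousOn_primitive_interval (μ := volume) (f := v) (a := 0)
    (b := s) (by
      rw [uIcc_of_le hs]; exact (intervalIntegrable_iff_integrableOn_Icc_of_le hs).1 h.1)
  rw [uIcc_of_le hs] at h1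
  exact (continuousOn_const.add h1).congr h.2

theorem mono (h : IsPrimitiveOn s v z) {r : ℝ} (hr : r ∈ Icc 0 s) : IsPrimitiveOn r v z :=
  ⟨h.intervalIntegrable ⟨le_rfl, hr.1.trans hr.2⟩ hr, fun t ht => h.2 t ⟨ht.1, ht.2.trans hr.2⟩⟩

theorem lipschitzOnWith (h : IsPrimitiveOn s v z) {C : NNReal}
    (hC : ∀ᵐ t ∂(volume.restrict (Icc 0 s)), ‖v t‖ ≤ C) : LipschitzOnWith C z (Icc 0 s) := by
  refine LipschitzOnWith.of_dist_le_mul fun a ha b hb => ?_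
  rw [dist_eq_norm, h.sub_eq hb ha, Real.dist_eq]
  refine intervalIntegral.norm_integral_le_of_norm_le_const_ae ?_
  filter_upwards [(ae_restrict_iff' measurableSet_Icc).1 hC] with t ht hab
  exact ht (uIcc_subset_Icc hb ha (uIoc_subset_uIcc hab))

/-- Concatenation of primitives: `z'`, delayed by `s`, continues `z` after time `s`. -/
theorem concat {r : ℝ} {v' z' : ℝ → E} (h : IsPrimitiveOn s v z) (h' : IsPrimitiveOn r v' z')
    (hs : 0 ≤ s) (hr : 0 ≤ r) (hzz : z' 0 = z s) :
    IsPrimitiveOn (s + r) (fun t => if t ≤ s then v t else v' (t - s))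
      (fun t => if t ≤ s then z t else z' (t - s)) := by
  set V : ℝ → E := fun t => if t ≤ s then v t else v' (t - s) with hV
  have hleft : ∀ t ∈ Icc 0 s, EqOn v V (uIoc 0 t) := fun t ht τ hτ => by
    rw [uIoc_of_le ht.1] at hτ
    simp [hV, hτ.2.trans ht.2]
  have hright : ∀ t ≥ s, EqOn (fun τ => v' (τ - s)) V (uIoc s t) := fun t ht τ hτ => by
    rw [uIoc_of_le ht] at hτ
    simp [hV, hτ.1]
  have hcongr : ∀ {f g : ℝ → E} {a b : ℝ}, EqOn f g (uIoc a b) →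
      ∫ τ in a..b, f τ = ∫ τ in a..b, g τ := fun hfg =>
    intervalIntegral.integral_congr_ae (ae_of_all _ hfg)
  have hss : s ∈ Icc 0 s := ⟨hs, le_rfl⟩
  have hi1 : IntervalIntegrable V volume 0 s := h.1.congr (hleft s hss)
  have hi2 : ∀ t ∈ Icc s (s + r), IntervalIntegrable V volume s t := fun t ht => by
    refine IntervalIntegrable.congr (hright t ht.1) ?_
    have := (h'.intervalIntegrable (a := 0) (b := t - s) ⟨le_rfl, hr⟩
      ⟨by linarith [ht.1], by linarith [ht.2]⟩).comp_sub_right s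
    simpa using this
  refine ⟨hi1.trans (hi2 _ ⟨by linarith, le_rfl⟩), fun t ht => ?_⟩
  rcases le_or_gt t s with hts | hts
  · simp only [hts, if_true, hs]
    rw [h.2 t ⟨ht.1, hts⟩, hcongr (hleft t ⟨ht.1, hts⟩)]
  · simp only [hts.not_ge, if_false, hs, if_true]
    have h2 := hi2 t ⟨hts.le, ht.2⟩
    rw [← intervalIntegral.integral_add_adjacent_intervals hi1 h2,
      ← hcongr (hleft s hss),
      ← hcongr (hright t hts.le),
      intervalIntegral.integral_comp_sub_right (fun τ => v' τ), sub_self, ← add_assoc,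
      ← h.2 s hss, ← hzz]
    exact h'.2 _ ⟨by linarith, by linarith [ht.2]⟩

end IsPrimitiveOn

theorem IsInclusionSolution.concat {G : E → Set E} {s r : ℝ} {z z' : ℝ → E}
    (h : IsInclusionSolution G s z) (h' : IsInclusionSolution G r z')
    (hs : 0 ≤ s) (hr : 0 ≤ r) (hzz : z' 0 = z s) :
    IsInclusionSolution G (s + r) (fun t => if t ≤ s then z t else z' (t - s)) := by
  obtain ⟨v, hv, hG⟩ := h
  obtain ⟨v', hv', hG'⟩ := h'
  refine ⟨_, hv.concat hv' hs hr hzz, ?_⟩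
  rw [ae_restrict_iff' measurableSet_Icc] at hG hG' ⊢
  have hG'' := (measurePreserving_sub_right (volume : Measure ℝ) s).quasiMeasurePreserving.ae hG'
  filter_upwards [hG, hG''] with t ht ht' hts
  split_ifs with hle
  · exact ht ⟨hts.1, hle⟩
  · exact ht' ⟨by linarith, by linarith [hts.2]⟩

variable [FiniteDimensional ℝ E]

/-- If curves `z k` with velocities in `G (w k)` converge uniformly to `y`, and so do the `w k`, then
the derivative of `y`, where it exists, lies in `G (y t)`. The difference quotients of `z k` are
averages of velocities, all of which lie in a closed convex thickening of `G (y t)`. -/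
theorem hasDerivAt_mem_of_tendstoUniformlyOn {G : E → Set E} (hGu : IsUpperSemicontinuousMap G)
    (hGc : ∀ e, Convex ℝ (G e)) (hGcl : ∀ e, IsClosed (G e)) {s : ℝ}
    {z v w : ℕ → ℝ → E} {y : ℝ → E} (hz : ∀ k, IsPrimitiveOn s (v k) (z k))
    (hvG : ∀ k, ∀ᵐ t ∂(volume.restrict (Icc 0 s)), v k t ∈ G (w k t))
    (hw : ∀ ε > 0, ∀ᶠ k in atTop, ∀ t ∈ Icc 0 s, dist (w k t) (z k t) < ε)
    (hzy : TendstoUniformlyOn z y atTop (Icc 0 s)) {t : ℝ} {d : E} (ht : t ∈ Ioo 0 s)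
    (hd : HasDerivAt y d t) : d ∈ G (y t) := by
  have := FiniteDimensional.complete ℝ E
  rw [← (hGcl (y t)).closure_eq, Metric.closure_eq_iInter_cthickening]
  refine mem_iInter₂.2 fun ε hε => ?_
  set K := Metric.cthickening ε (G (y t)) with hK
  have hKcl : IsClosed K := Metric.isClosed_cthickening
  have hKc : Convex ℝ K := (hGc _).cthickening ε
  obtain ⟨δ, hδ, hGδ⟩ := Metric.eventually_nhds_iff.1 (hGu (y t) ε hε)
  obtain ⟨η, hη, hyη⟩ := Metric.continuousAt_iff.1 hd.continuousAt (δ / 3) (by positivity)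
  refine hKcl.mem_of_tendsto hd.tendsto_slope_zero_right ?_
  have hpos : 0 < min η (s - t) := lt_min hη (sub_pos.2 ht.2)
  filter_upwards [Ioo_mem_nhdsGT hpos] with h hh
  have hhη : h < η := hh.2.trans_le (min_le_left _ _)
  have hhs : t + h < s := by linarith [hh.2.trans_le (min_le_right η (s - t))]
  have hts : t ∈ Icc 0 s := Ioo_subset_Icc_self ht
  have hths : t + h ∈ Icc 0 s := ⟨by linarith [ht.1, hh.1], hhs.le⟩
  refine hKcl.mem_of_tendsto (((hzy.tendsto_at hths).sub (hzy.tendsto_at hts)).const_smul h⁻¹) ?_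
  filter_upwards [hw (δ / 3) (by positivity),
    Metric.tendstoUniformlyOn_iff.1 hzy (δ / 3) (by positivity)] with k hwk hzk
  have hlt : t ≤ t + h := by linarith [hh.1]
  rw [(hz k).sub_eq hts hths]
  have havg : h⁻¹ • ∫ τ in t..(t + h), v k τ = ⨍ τ in t..(t + h), v k τ := by
    rw [interval_average_eq, add_sub_cancel_left]
  rw [havg, uIoc_of_le hlt]
  refine hKc.set_average_mem hKcl ?_ ?_ ?_ ?_
  · simp [hh.1]
  · simp
  · have hsub : Ioc t (t + h) ⊆ Icc 0 s := fun τ hτ =>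
      ⟨(ht.1.trans hτ.1).le, hτ.2.trans hhs.le⟩
    have h1 := ae_restrict_of_ae_restrict_of_subset hsub (hvG k)
    filter_upwards [h1, ae_restrict_mem measurableSet_Ioc] with τ hτ hτm
    refine hGδ ?_ hτ
    have hτη : dist τ t < η := by
      rw [Real.dist_eq, abs_of_pos (sub_pos.2 hτm.1)]; linarith [hτm.2]
    have e1 := hwk τ (hsub hτm)
    have e2 := hzk τ (hsub hτm)
    have e3 := hyη hτη
    rw [dist_comm] at e2
    linarith [dist_triangle4 (w k τ) (z k τ) (y τ) (y t)]
  · exact (intervalIntegrable_iff_integrableOn_Ioc_of_le hlt).1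
      ((hz k).intervalIntegrable hts hths)

/-- Compactness of approximate solutions: here `v k` is the velocity of `z k`, and it lies in the
value of `G` at a point `w k t` which is uniformly close to `z k t`. For exact solutions
`w = z`; for Euler polygons `w k t` is the last node before `t`. -/
theorem exists_subseq_tendstoUniformlyOn_inclusionSolution {G : E → Set E}
    (hGu : IsUpperSemicontinuousMap G)
    (hGc : ∀ e, Convex ℝ (G e)) (hGcl : ∀ e, IsClosed (G e)) {s r : ℝ} (hs : 0 ≤ s)
    {C : NNReal} {z v w : ℕ → ℝ → E} (hz : ∀ k, IsPrimitiveOn s (v k) (z k))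
    (hvC : ∀ k, ∀ᵐ t ∂(volume.restrict (Icc 0 s)), ‖v k t‖ ≤ C)
    (hvG : ∀ k, ∀ᵐ t ∂(volume.restrict (Icc 0 s)), v k t ∈ G (w k t))
    (hw : ∀ ε > 0, ∀ᶠ k in atTop, ∀ t ∈ Icc 0 s, dist (w k t) (z k t) < ε)
    (h0 : ∀ k, ‖z k 0‖ ≤ r) :
    ∃ (φ : ℕ → ℕ) (y : ℝ → E), StrictMono φ ∧ IsInclusionSolution G s y ∧
      TendstoUniformlyOn (fun k => z (φ k)) y atTop (Icc 0 s) := by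
  obtain ⟨φ, y, hφ, hy, hlim⟩ := exists_subseq_tendstoUniformlyOn_of_lipschitzOnWith hs
    (fun k => (hz k).lipschitzOnWith (hvC k)) h0
  refine ⟨φ, y, hφ, ⟨deriv y, ⟨?_, fun t _ => ?_⟩, ?_⟩, hlim⟩
  · exact (hy.intervalIntegrable_deriv_and_integral_deriv 0 s).1
  · rw [(hy.intervalIntegrable_deriv_and_integral_deriv 0 t).2, add_sub_cancel]
  · rw [← restrict_Ioo_eq_restrict_Icc]
    filter_upwards [ae_restrict_of_ae hy.ae_differentiableAt_real,
      ae_restrict_mem measurableSet_Ioo] with t ht hts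
    exact hasDerivAt_mem_of_tendstoUniformlyOn hGu hGc hGcl (fun k => hz (φ k))
      (fun k => hvG (φ k)) (fun ε hε => hφ.tendsto_atTop.eventually (hw ε hε)) hlim hts
      ht.hasDerivAt

/-- Existence of solutions for a bounded upper semicontinuous inclusion with nonempty closed convex
values, as limits of Euler polygons. -/
theorem exists_inclusionSolution {G : E → Set E} (hGu : IsUpperSemicontinuousMap G)
    (hGc : ∀ e, Convex ℝ (G e)) (hGcl : ∀ e, IsClosed (G e)) (hGne : ∀ e, (G e).Nonempty)
    {C : NNReal} (hGC : ∀ e, ∀ v ∈ G e, ‖v‖ ≤ C) {s : ℝ} (hs : 0 ≤ s) (z₀ : E) :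
    ∃ z, z 0 = z₀ ∧ IsInclusionSolution G s z := by
  have := FiniteDimensional.complete ℝ E
  choose γ hγ using hGne
  have hN : ∀ k : ℕ, (0 : ℝ) < k + 1 := fun k => by positivity
  -- Euler polygons with step `1 / (k + 1)`
  let node : ℕ → ℕ → E := fun k j =>
    Nat.rec z₀ (fun _ e => e + ((k : ℝ) + 1)⁻¹ • γ e) j
  let w : ℕ → ℝ → E := fun k t => node k ⌊t * (k + 1)⌋₊
  let v : ℕ → ℝ → E := fun k t => γ (w k t)
  let z : ℕ → ℝ → E := fun k t => z₀ + ∫ τ in (0 : ℝ)..t, v k τ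
  have hvm : ∀ k, StronglyMeasurable (v k) := fun k => by
    have h1 : StronglyMeasurable fun j : ℕ => γ (node k j) := .of_discrete
    exact h1.comp_measurable (Nat.measurable_floor.comp (measurable_id.mul_const _))
  have hvb : ∀ k t, ‖v k t‖ ≤ C := fun k t => hGC _ _ (hγ _)
  have hvi : ∀ k a b, IntervalIntegrable (v k) volume a b := fun k a b =>
    (intervalIntegrable_const (c := (C : ℝ))).mono_fun (hvm k).aestronglyMeasurable
      (ae_of_all _ fun t => by simpa using hvb k t)
  have hz0 : ∀ k, z k 0 = z₀ := fun k => by simp [z]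
  have hz : ∀ k, IsPrimitiveOn s (v k) (z k) := fun k =>
    ⟨hvi k 0 s, fun t _ => by rw [hz0]⟩
  have hzsub : ∀ k a b, z k b - z k a = ∫ τ in a..b, v k τ := fun k a b => by
    simp only [z]
    rw [add_sub_add_left_eq_sub, intervalIntegral.integral_interval_sub_left (hvi _ _ _)
      (hvi _ _ _)]
  have hnode : ∀ k j : ℕ, z k (j / (k + 1)) = node k j := fun k j => by
    induction j with
    | zero => simp [hz0, node]
    | succ j ih =>
      have hle : (j : ℝ) / (k + 1) ≤ (j + 1 : ℕ) / (k + 1) := by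
        gcongr; exact j.le_succ
      have hconst : ∫ τ in ((j : ℝ) / (k + 1))..((j + 1 : ℕ) / (k + 1)), v k τ
          = ((k : ℝ) + 1)⁻¹ • γ (node k j) := by
        rw [intervalIntegral.integral_congr_ae (g := fun _ => γ (node k j)),
          intervalIntegral.integral_const]
        · congr 1
          push_cast; field_simp; ring
        · filter_upwards [Measure.ae_ne volume (((j + 1 : ℕ) : ℝ) / (k + 1))] with τ hne hτ
          rw [uIoc_of_le hle] at hτ
          have hfl : ⌊τ * (k + 1)⌋₊ = j := by
            rw [Nat.floor_eq_iff (by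
              have : (0 : ℝ) ≤ j / (k + 1) := by positivity
              exact mul_nonneg (this.trans hτ.1.le) (hN k).le)]
            refine ⟨((div_lt_iff₀ (hN k)).1 hτ.1).le, ?_⟩
            have := (lt_div_iff₀ (hN k)).1 (lt_of_le_of_ne hτ.2 hne)
            exact_mod_cast this
          simp only [v, w, hfl]
      have := hzsub k (j / (k + 1)) ((j + 1 : ℕ) / (k + 1))
      rw [hconst, ih, sub_eq_iff_eq_add] at this
      rw [this, add_comm]
  have hwz : ∀ k, ∀ t ≥ 0, dist (w k t) (z k t) ≤ C / (k + 1) := fun k t ht => by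
    have hw : w k t = z k (⌊t * (k + 1)⌋₊ / (k + 1)) := (hnode k _).symm
    rw [hw, dist_comm, dist_eq_norm, hzsub]
    refine (intervalIntegral.norm_integral_le_of_norm_le_const fun τ _ => hvb k τ).trans ?_
    have h1 : (⌊t * (k + 1)⌋₊ : ℝ) ≤ t * (k + 1) :=
      Nat.floor_le (mul_nonneg ht (hN k).le)
    have h2 := (Nat.lt_floor_add_one (t * ((k : ℝ) + 1))).le
    have h3 : |t - ⌊t * ((k : ℝ) + 1)⌋₊ / (k + 1)| ≤ 1 / (k + 1) := by
      rw [abs_of_nonneg (sub_nonneg.2 ((div_le_iff₀ (hN k)).2 h1)), sub_le_iff_le_add,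
        ← add_div, le_div_iff₀ (hN k)]
      linarith
    calc (C : ℝ) * |t - ⌊t * ((k : ℝ) + 1)⌋₊ / (k + 1)| ≤ C * (1 / (k + 1)) := by gcongr
      _ = C / (k + 1) := by ring
  have hlim : Tendsto (fun k : ℕ => (C : ℝ) / (k + 1)) atTop (𝓝 0) := by
    have := (tendsto_one_div_add_atTop_nhds_zero_nat (𝕜 := ℝ)).const_mul (C : ℝ)
    simpa [div_eq_mul_inv] using this
  obtain ⟨φ, y, -, hy, hlim⟩ := exists_subseq_tendstoUniformlyOn_inclusionSolution hGu hGc hGcl hs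
    hz (w := w) (fun k => ae_of_all _ (hvb k)) (fun k => ae_of_all _ fun t => hγ _)
    (fun ε hε => (hlim.eventually_lt_const hε).mono fun k hk t ht =>
      (hwz k t ht.1).trans_lt hk) (r := ‖z₀‖) (fun k => by rw [hz0])
  refine ⟨y, ?_, hy⟩
  refine tendsto_nhds_unique (hlim.tendsto_at ⟨le_rfl, hs⟩) ?_
  simp [hz0]

end Inclusion

/-! ### Primitives in product spaces, growth bounds and radial retractions -/

section Primitive

variable {E F : Type*} [NormedAddCommGroup E] [NormedSpace ℝ E] [NormedAddCommGroup F]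
  [NormedSpace ℝ F]

theorem IsPrimitiveOn.clm_comp [CompleteSpace E] [CompleteSpace F] {s : ℝ} {v z : ℝ → E}
    (h : IsPrimitiveOn s v z) (ℓ : E →L[ℝ] F) :
    IsPrimitiveOn s (fun t => ℓ (v t)) (fun t => ℓ (z t)) := by
  have hi : ∀ t ∈ Icc 0 s, IntervalIntegrable v volume 0 t := fun t ht => (h.mono ht).1
  refine ⟨?_, fun t ht => ?_⟩
  · exact ⟨ℓ.integrable_comp h.1.1, ℓ.integrable_comp h.1.2⟩
  · rw [ℓ.intervalIntegral_comp_comm (hi t ht), ← map_add, ← h.2 t ht]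

theorem IsPrimitiveOn.prodMk {s : ℝ} {v z : ℝ → E} {v' z' : ℝ → F}
    [CompleteSpace E] [CompleteSpace F]
    (h : IsPrimitiveOn s v z) (h' : IsPrimitiveOn s v' z') :
    IsPrimitiveOn s (fun t => (v t, v' t)) (fun t => (z t, z' t)) := by
  refine ⟨⟨h.1.1.prodMk h'.1.1, h.1.2.prodMk h'.1.2⟩, fun t ht => ?_⟩
  rw [intervalIntegral.integral_of_le ht.1, integral_pair (h.mono ht).1.1 (h'.mono ht).1.1,
    ← intervalIntegral.integral_of_le ht.1, ← intervalIntegral.integral_of_le ht.1,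
    Prod.mk_add_mk, ← h.2 t ht, ← h'.2 t ht]

theorem IsPrimitiveOn.congr_ae {s : ℝ} (hs : 0 ≤ s) {v v' z : ℝ → E} (h : IsPrimitiveOn s v z)
    (hv : ∀ᵐ t ∂(volume.restrict (Icc 0 s)), v t = v' t) : IsPrimitiveOn s v' z := by
  have hv' : ∀ t ∈ Icc 0 s, ∀ᵐ τ, τ ∈ uIoc 0 t → v τ = v' τ := fun t ht => by
    filter_upwards [(ae_restrict_iff' measurableSet_Icc).1 hv] with τ hτ hτt
    rw [uIoc_of_le ht.1] at hτt
    exact hτ ⟨hτt.1.le, hτt.2.trans ht.2⟩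
  refine ⟨h.1.congr_ae ((ae_restrict_iff' measurableSet_uIoc).2 (hv' s ⟨hs, le_rfl⟩)),
    fun t ht => ?_⟩
  rw [h.2 t ht, intervalIntegral.integral_congr_ae (hv' t ht)]

/-- Gronwall's inequality for a curve whose speed is at most `L` times its norm. -/
theorem IsPrimitiveOn.norm_le_mul_exp {s L : ℝ} (hL : 0 ≤ L) {v z : ℝ → E}
    (h : IsPrimitiveOn s v z) (hv : ∀ᵐ t ∂(volume.restrict (Icc 0 s)), ‖v t‖ ≤ L * ‖z t‖) :
    ∀ t ∈ Icc 0 s, ‖z t‖ ≤ ‖z 0‖ * Real.exp (L * t) := by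
  refine le_mul_exp_of_le_add_integral hL h.continuousOn.norm fun t ht => ?_
  have hzi : IntervalIntegrable (fun τ => L * ‖z τ‖) volume 0 t := by
    refine ContinuousOn.intervalIntegrable ?_
    rw [uIcc_of_le ht.1]
    exact (h.mono ht).continuousOn.norm.const_smul L
  rw [← intervalIntegral.integral_const_mul]
  have h1 : ‖∫ τ in (0 : ℝ)..t, v τ‖ ≤ ∫ τ in (0 : ℝ)..t, L * ‖z τ‖ := by
    refine intervalIntegral.norm_integral_le_of_norm_le ht.1 ?_ hzi
    filter_upwards [(ae_restrict_iff' measurableSet_Icc).1 hv] with τ hτ hτt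
    exact hτ ⟨hτt.1.le, hτt.2.trans ht.2⟩
  calc ‖z t‖ = ‖z 0 + ∫ τ in (0 : ℝ)..t, v τ‖ := by rw [← h.2 t ht]
    _ ≤ _ := (norm_add_le _ _).trans (add_le_add_right h1 _)

/-- The radial retraction of a normed space onto the closed ball of radius `r` about `0`, for
`0 < r`. -/
def radialRetraction (r : ℝ) (x : E) : E := (r / max r ‖x‖) • x

theorem continuous_radialRetraction {r : ℝ} (hr : 0 < r) :
    Continuous (radialRetraction r : E → E) := by
  unfold radialRetraction
  refine Continuous.smul (continuous_const.div (by fun_prop) fun x => ?_) continuous_id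
  exact (lt_max_of_lt_left hr).ne'

theorem radialRetraction_of_norm_le {r : ℝ} (hr : 0 < r) {x : E} (hx : ‖x‖ ≤ r) :
    radialRetraction r x = x := by
  rw [radialRetraction, max_eq_left hx, div_self hr.ne', one_smul]

theorem norm_radialRetraction_le {r : ℝ} (hr : 0 < r) (x : E) : ‖radialRetraction r x‖ ≤ r := by
  have h : 0 < max r ‖x‖ := lt_max_of_lt_left hr
  rw [radialRetraction, norm_smul, Real.norm_of_nonneg (by positivity), div_mul_eq_mul_div,
    div_le_iff₀ h]
  gcongr
  exact le_max_right _ _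

theorem norm_radialRetraction_le_norm {r : ℝ} (hr : 0 < r) (x : E) :
    ‖radialRetraction r x‖ ≤ ‖x‖ := by
  have h : 0 < max r ‖x‖ := lt_max_of_lt_left hr
  rw [radialRetraction, norm_smul, Real.norm_of_nonneg (by positivity)]
  exact mul_le_of_le_one_left (norm_nonneg _) ((div_le_one h).2 (le_max_left _ _))

end Primitive

/-! ### The inclusion satisfied by extremals -/

theorem isCaratheodorySolution_iff {n : ℕ} {s : ℝ} (hs : 0 ≤ s) {y₀ : Vec n}
    {g y : ℝ → Vec n} :
    IsCaratheodorySolution s y₀ g y ↔ IsPrimitiveOn s g y ∧ y 0 = y₀ := by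
  constructor
  · rintro ⟨-, hi, h⟩
    have h0 : y 0 = y₀ := by simpa using h 0 ⟨le_rfl, hs⟩
    exact ⟨⟨hi, by rwa [h0]⟩, h0⟩
  · rintro ⟨h, rfl⟩
    exact ⟨h.continuousOn, h.1, h.2⟩

section Extremal

variable {n m : ℕ} {f : Vec n → Vec m → Vec n} {Ω : Set (Vec m)}

/-- The joint velocity of state and costate at `z = (χ, p)` under the control value `u`. -/
def extremalField (f : Vec n → Vec m → Vec n) (z : Vec n × Vec n) (u : Vec m) : Vec n × Vec n :=
  (f z.1 u, adjointField f z.1 z.2 u)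

theorem extremalVelocities_eq_image (z : Vec n × Vec n) :
    extremalVelocities f Ω z.1 z.2 = extremalField f z '' maximizers f Ω z.1 z.2 := by
  ext w
  simp only [extremalVelocities, mem_ofPred_eq, mem_image, extremalField, eq_comm]

theorem continuous_fderiv_fst (hf : ContDiff ℝ 1 (fun z : Vec n × Vec m => f z.1 z.2)) :
    Continuous fun q : Vec n × Vec m => fderiv ℝ (fun x => f x q.2) q.1 := by
  have h : ∀ q : Vec n × Vec m, fderiv ℝ (fun x => f x q.2) q.1 =
      (fderiv ℝ (fun z : Vec n × Vec m => f z.1 z.2) q).comp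
        (ContinuousLinearMap.inl ℝ (Vec n) (Vec m)) := fun q => by
    have h1 : HasFDerivAt (fun z : Vec n × Vec m => f z.1 z.2) _ (q.1, q.2) :=
      (hf.differentiable one_ne_zero q).hasFDerivAt
    exact (HasFDerivAt.comp (f := fun x => (x, q.2)) q.1 h1
      (hasFDerivAt_prodMk_left q.1 q.2)).fderiv
  simp_rw [h]
  exact (hf.continuous_fderiv one_ne_zero).clm_comp continuous_const

theorem continuous_extremalField (hf : ContDiff ℝ 1 (fun z : Vec n × Vec m => f z.1 z.2)) :
    Continuous fun q : (Vec n × Vec n) × Vec m => extremalField f q.1 q.2 := by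
  refine (hf.continuous.comp (by fun_prop : Continuous fun q : (Vec n × Vec n) × Vec m =>
    (q.1.1, q.2))).prodMk ?_
  have h1 : Continuous fun q : (Vec n × Vec n) × Vec m =>
      fderiv ℝ (fun x => f x q.2) q.1.1 :=
    (continuous_fderiv_fst hf).comp (by fun_prop : Continuous fun q : (Vec n × Vec n) × Vec m =>
      (q.1.1, q.2))
  exact ((ContinuousLinearMap.adjoint.continuous.comp h1).clm_apply
    (by fun_prop : Continuous fun q : (Vec n × Vec n) × Vec m => q.1.2)).neg

theorem isClosed_graph_maximizers (hf : ContDiff ℝ 1 (fun z : Vec n × Vec m => f z.1 z.2))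
    (hΩ : IsClosed Ω) :
    IsClosed {q : (Vec n × Vec n) × Vec m | q.2 ∈ maximizers f Ω q.1.1 q.1.2} := by
  have hfc : ∀ {X : Type} [TopologicalSpace X] {a : X → Vec n} {b : X → Vec m},
      Continuous a → Continuous b → Continuous fun x => f (a x) (b x) := fun ha hb =>
    hf.continuous.comp (ha.prodMk hb)
  have : {q : (Vec n × Vec n) × Vec m | q.2 ∈ maximizers f Ω q.1.1 q.1.2} =
      {q | q.2 ∈ Ω} ∩ ⋂ v ∈ Ω, {q | hamiltonian f q.1.1 q.1.2 v ≤
        hamiltonian f q.1.1 q.1.2 q.2} := by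
    ext q; simp [maximizers]
  rw [this]
  refine (hΩ.preimage continuous_snd).inter (isClosed_biInter fun v _ => isClosed_le ?_ ?_)
  · exact Continuous.inner (by fun_prop) (hfc (by fun_prop) continuous_const)
  · exact Continuous.inner (by fun_prop) (hfc (by fun_prop) (by fun_prop))

theorem maximizers_nonempty (hf : ContDiff ℝ 1 (fun z : Vec n × Vec m => f z.1 z.2))
    (hΩ : IsCompact Ω) (hne : Ω.Nonempty) (χ p : Vec n) : (maximizers f Ω χ p).Nonempty := by
  have hc : Continuous fun u => hamiltonian f χ p u :=
    continuous_const.inner (hf.continuous.comp (Continuous.prodMk_right χ))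
  obtain ⟨u, hu, hmax⟩ := hΩ.exists_isMaxOn hne hc.continuousOn
  exact ⟨u, hu, fun v hv => hmax hv⟩

theorem isClosed_extremalVelocities (hf : ContDiff ℝ 1 (fun z : Vec n × Vec m => f z.1 z.2))
    (hΩ : IsCompact Ω) (z : Vec n × Vec n) : IsClosed (extremalVelocities f Ω z.1 z.2) := by
  rw [extremalVelocities_eq_image]
  have h1 : IsClosed (maximizers f Ω z.1 z.2) :=
    (isClosed_graph_maximizers hf hΩ.isClosed).preimage (Continuous.prodMk_right z)
  have h2 : IsCompact (maximizers f Ω z.1 z.2) := hΩ.of_isClosed_subset h1 fun u hu => hu.1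
  exact (h2.image ((continuous_extremalField hf).comp (Continuous.prodMk_right z))).isClosed

/-- The maximizers form a closed-graph map into the compact set `Ω`, so their velocities depend
upper semicontinuously on `(χ, p)`. -/
theorem isUpperSemicontinuousMap_extremalVelocities
    (hf : ContDiff ℝ 1 (fun z : Vec n × Vec m => f z.1 z.2)) (hΩ : IsCompact Ω) :
    IsUpperSemicontinuousMap fun z : Vec n × Vec n => extremalVelocities f Ω z.1 z.2 := by
  intro z ε hε
  have hgraph := isClosed_graph_maximizers hf hΩ.isClosed
  have h : ∀ u ∈ Ω, ∀ᶠ q : (Vec n × Vec n) × Vec m in 𝓝 (z, u),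
      q.2 ∈ maximizers f Ω q.1.1 q.1.2 →
        extremalField f q.1 q.2 ∈ Metric.thickening ε (extremalVelocities f Ω z.1 z.2) := by
    intro u _
    by_cases hu : u ∈ maximizers f Ω z.1 z.2
    · have hmem : extremalField f z u ∈
          Metric.thickening ε (extremalVelocities f Ω z.1 z.2) :=
        Metric.self_subset_thickening hε _ ⟨u, hu, rfl⟩
      filter_upwards [(continuous_extremalField hf).continuousAt.eventually
        (Metric.isOpen_thickening.mem_nhds hmem)] with q hq _
      exact hq
    -- a non-maximizer stays one under small perturbations of `z` and `u`
    · filter_upwards [hgraph.isOpen_compl.mem_nhds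
        (show (z, u) ∈ {q : (Vec n × Vec n) × Vec m | _}ᶜ from hu)] with q hq hq'
      exact absurd hq' hq
  filter_upwards [hΩ.eventually_forall_of_forall_eventually
    (P := fun z' u => u ∈ maximizers f Ω z'.1 z'.2 →
      extremalField f z' u ∈ Metric.thickening ε (extremalVelocities f Ω z.1 z.2)) h] with z' hz' w hw
  rw [extremalVelocities_eq_image] at hw
  obtain ⟨u, hu, rfl⟩ := hw
  exact Metric.thickening_subset_cthickening _ _ (hz' u hu.1 hu)

theorem exists_bound_extremalField (hf : ContDiff ℝ 1 (fun z : Vec n × Vec m => f z.1 z.2))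
    (hΩ : IsCompact Ω) (M : ℝ) :
    ∃ C ≥ 0, ∀ x p, ‖x‖ ≤ M → ∀ u ∈ Ω, ‖f x u‖ ≤ C ∧ ‖adjointField f x p u‖ ≤ C * ‖p‖ := by
  have hK : IsCompact (Metric.closedBall (0 : Vec n) M ×ˢ Ω) :=
    (isCompact_closedBall _ _).prod hΩ
  obtain ⟨C₁, hC₁⟩ := hK.exists_bound_of_continuousOn hf.continuous.continuousOn
  obtain ⟨C₂, hC₂⟩ := hK.exists_bound_of_continuousOn (continuous_fderiv_fst hf).continuousOn
  refine ⟨max 0 (max C₁ C₂), le_max_left _ _, fun x p hx u hu => ?_⟩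
  have hmem : (x, u) ∈ Metric.closedBall (0 : Vec n) M ×ˢ Ω :=
    ⟨mem_closedBall_zero_iff.2 hx, hu⟩
  refine ⟨(hC₁ _ hmem).trans ((le_max_left _ _).trans (le_max_right _ _)), ?_⟩
  rw [adjointField, norm_neg]
  refine (ContinuousLinearMap.le_opNorm _ _).trans ?_
  rw [LinearIsometryEquiv.norm_map]
  gcongr
  exact (hC₂ _ hmem).trans ((le_max_right _ _).trans (le_max_right _ _))

theorem isPrimitiveOn_of_mem_extremalTriples {χi : Vec n} {s : ℝ} (hs : 0 ≤ s)
    {χ p : ℝ → Vec n} {u : ℝ → Vec m} (h : (χ, p, u) ∈ extremalTriples f Ω χi s) :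
    IsPrimitiveOn s (fun t => extremalField f (χ t, p t) (u t)) (fun t => (χ t, p t)) ∧
      ∀ᵐ t ∂(volume.restrict (Icc 0 s)),
        extremalField f (χ t, p t) (u t) ∈ extremalVelocities f Ω (χ t) (p t) := by
  obtain ⟨⟨-, hχ⟩, hp, -, hmax⟩ := h
  refine ⟨((isCaratheodorySolution_iff hs).1 hχ).1.prodMk
    ((isCaratheodorySolution_iff hs).1 hp).1, ?_⟩
  filter_upwards [hmax] with t ht
  exact ⟨u t, ht, rfl⟩

/-- A solution of the inclusion comes from a measurable control (Filippov's lemma). The control is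
selected as a Borel function of the pair (point, velocity), with values in `Ω` at every time. -/
theorem exists_control_of_isInclusionSolution
    (hf : ContDiff ℝ 1 (fun z : Vec n × Vec m => f z.1 z.2)) (hΩ : IsCompact Ω)
    (hne : Ω.Nonempty) {s : ℝ} (hs : 0 ≤ s) {z : ℝ → Vec n × Vec n}
    (hz : IsInclusionSolution (fun z => extremalVelocities f Ω z.1 z.2) s z) :
    ∃ u, IsResponse f Ω (z 0).1 s (fun t => (z t).1) u ∧
      IsCaratheodorySolution s (z 0).2
        (fun τ => adjointField f (z τ).1 (z τ).2 (u τ)) (fun t => (z t).2) ∧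
      ∀ᵐ t ∂(volume.restrict (Icc 0 s)), u t ∈ maximizers f Ω (z t).1 (z t).2 := by
  obtain ⟨v, hv, hG⟩ := hz
  have hR : IsClosed {q : ((Vec n × Vec n) × (Vec n × Vec n)) × Vec m |
      q.2 ∈ maximizers f Ω q.1.1.1 q.1.1.2 ∧ extremalField f q.1.1 q.2 = q.1.2} := by
    have hproj : Continuous fun q : ((Vec n × Vec n) × (Vec n × Vec n)) × Vec m =>
      (q.1.1, q.2) := by fun_prop
    exact ((isClosed_graph_maximizers hf hΩ.isClosed).preimage hproj).inter
      (isClosed_eq ((continuous_extremalField hf).comp hproj) (by fun_prop))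
  obtain ⟨σ, hσm, hσΩ, hσ⟩ := exists_measurable_selection hΩ hne hR
  set u : ℝ → Vec m := fun t => σ (z t, v t) with hu
  have hum : AEMeasurable u (volume.restrict (Icc 0 s)) := by
    refine hσm.comp_aemeasurable ((hv.continuousOn.aemeasurable measurableSet_Icc).prodMk ?_)
    exact ((intervalIntegrable_iff_integrableOn_Icc_of_le hs).1
      hv.1).aestronglyMeasurable.aemeasurable
  have hae : ∀ᵐ t ∂(volume.restrict (Icc 0 s)),
      u t ∈ maximizers f Ω (z t).1 (z t).2 ∧ v t = extremalField f (z t) (u t) := by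
    filter_upwards [hG] with t ht
    obtain ⟨w, hw, hwv⟩ := ht
    have := hσ (z t, v t) ⟨w, hw.1, hw, hwv.symm⟩
    exact ⟨this.1, this.2.symm⟩
  have hz' : IsPrimitiveOn s (fun t => extremalField f (z t) (u t)) z :=
    hv.congr_ae hs (hae.mono fun t ht => ht.2)
  refine ⟨u, ⟨⟨hum, fun t _ => hσΩ _⟩, ?_⟩, ?_, hae.mono fun t ht => ht.1⟩
  · exact (isCaratheodorySolution_iff hs).2
      ⟨hz'.clm_comp (ContinuousLinearMap.fst ℝ (Vec n) (Vec n)), rfl⟩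
  · exact (isCaratheodorySolution_iff hs).2
      ⟨hz'.clm_comp (ContinuousLinearMap.snd ℝ (Vec n) (Vec n)), rfl⟩

/-- Multiplying the costate by a positive constant preserves the conditions on a triple. -/
theorem smul_mem_extremalTriples {χi : Vec n} {s c : ℝ} (hc : 0 < c)
    {χ p : ℝ → Vec n} {u : ℝ → Vec m} (h : (χ, p, u) ∈ extremalTriples f Ω χi s) :
    (χ, fun t => c • p t, u) ∈ extremalTriples f Ω χi s := by
  obtain ⟨hχ, ⟨hpc, hpi, hp⟩, ⟨t, ht, hpt⟩, hmax⟩ := h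
  have hadj : (fun τ => adjointField f (χ τ) (c • p τ) (u τ)) =
      fun τ => c • adjointField f (χ τ) (p τ) (u τ) := by
    ext1 τ; simp [adjointField]
  refine ⟨hχ, ⟨hpc.const_smul c, ?_, fun t ht => ?_⟩, ⟨t, ht, smul_ne_zero hc.ne' hpt⟩, ?_⟩
  · simp only [hadj]; exact hpi.smul c
  · simp only [hadj]
    rw [intervalIntegral.integral_smul, ← smul_add]
    exact congrArg (c • ·) (hp t ht)
  · filter_upwards [hmax] with t ht
    refine ⟨ht.1, fun v hv => ?_⟩
    simp only [hamiltonian, real_inner_smul_left]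
    exact mul_le_mul_of_nonneg_left (ht.2 v hv) hc.le

theorem norm_costate_le {χi : Vec n} {s C M : ℝ} (hs : 0 ≤ s) (hC : 0 ≤ C)
    (hbd : ∀ x p, ‖x‖ ≤ M → ∀ u ∈ Ω, ‖f x u‖ ≤ C ∧ ‖adjointField f x p u‖ ≤ C * ‖p‖)
    {χ p : ℝ → Vec n} {u : ℝ → Vec m} (h : (χ, p, u) ∈ extremalTriples f Ω χi s)
    (hM : ∀ t ∈ Icc 0 s, ‖χ t‖ ≤ M) :
    ∀ t ∈ Icc 0 s, ‖p t‖ ≤ ‖p 0‖ * Real.exp (C * t) := by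
  refine ((isCaratheodorySolution_iff hs).1 h.2.1).1.norm_le_mul_exp hC ?_
  filter_upwards [ae_restrict_mem measurableSet_Icc] with t ht
  exact (hbd _ _ (hM t ht) _ (h.1.1.2 t ht)).2

end Extremal

/-! ### Extendability and compactness of extremals -/

section Main

variable {n m : ℕ} {f : Vec n → Vec m → Vec n} {Ω : Set (Vec m)} {χi : Vec n} {T tf : ℝ}

theorem IsExtremal.isExtendable
    (hf : ContDiff ℝ 1 (fun z : Vec n × Vec m => f z.1 z.2)) (hΩ : IsCompact Ω)
    (hbdd : UniformlyBoundedResponses f Ω χi T)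
    (hF : ∀ χ p : Vec n, Convex ℝ (extremalVelocities f Ω χ p)) (htf : tf ∈ Icc 0 T)
    {χ : ℝ → Vec n} (hχ : IsExtremal f Ω χi tf χ) : IsExtendable f Ω χi T tf χ := by
  obtain ⟨M, hM⟩ := hbdd
  obtain ⟨p, u, h⟩ := hχ
  have h0 : (0 : ℝ) ∈ Icc 0 tf := ⟨le_rfl, htf.1⟩
  have hχM := hM tf htf χ u h.1
  have hM0 : 0 < M := (norm_nonneg _).trans_lt (hχM 0 h0)
  have hne : Ω.Nonempty := ⟨u 0, h.1.1.2 0 h0⟩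
  have hχ0 : χ 0 = χi := ((isCaratheodorySolution_iff htf.1).1 h.1.2).2
  obtain ⟨C, hC, hbd⟩ := exists_bound_extremalField hf hΩ M
  -- the summand `1` only makes the radius positive
  set R : ℝ := ‖p 0‖ * Real.exp (C * T) + 1 with hR
  have hR0 : 0 < R := by positivity
  have hexp : ∀ t ≤ T, ‖p 0‖ * Real.exp (C * t) ≤ R := fun t ht => by
    have : ‖p 0‖ * Real.exp (C * t) ≤ ‖p 0‖ * Real.exp (C * T) := by gcongr
    linarith
  set P : Vec n × Vec n → Vec n × Vec n := fun z =>
    (radialRetraction M z.1, radialRetraction R z.2) with hP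
  have hPc : Continuous P := ((continuous_radialRetraction hM0).comp continuous_fst).prodMk
    ((continuous_radialRetraction hR0).comp continuous_snd)
  have hPid : ∀ z : Vec n × Vec n, ‖z.1‖ ≤ M → ‖z.2‖ ≤ R → P z = z := fun z h1 h2 =>
    Prod.ext (radialRetraction_of_norm_le hM0 h1) (radialRetraction_of_norm_le hR0 h2)
  set G : Vec n × Vec n → Set (Vec n × Vec n) := fun z =>
    extremalVelocities f Ω (P z).1 (P z).2 with hG
  have hGC : ∀ z, ∀ v ∈ G z, ‖v.1‖ ≤ C ∧ ‖v.2‖ ≤ C * ‖(P z).2‖ := by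
    rintro z _ ⟨w, hw, rfl⟩
    exact hbd _ _ (norm_radialRetraction_le hM0 _) _ hw.1
  -- the inclusion with truncated right-hand side is solvable on the remaining interval
  obtain ⟨z₂, hz₂0, hz₂⟩ := exists_inclusionSolution (G := G) (s := T - tf)
    (C := (max C (C * R)).toNNReal)
    (fun z ε hε => hPc.continuousAt.eventually
      (isUpperSemicontinuousMap_extremalVelocities hf hΩ (P z) ε hε))
    (fun z => hF _ _) (fun z => isClosed_extremalVelocities hf hΩ _)
    (fun z => by
      obtain ⟨w, hw⟩ := maximizers_nonempty hf hΩ hne (P z).1 (P z).2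
      exact ⟨_, w, hw, rfl⟩)
    (fun z v hv => by
      rw [Real.coe_toNNReal _ (le_max_of_le_left hC), Prod.norm_def]
      obtain ⟨h1, h2⟩ := hGC z v hv
      refine max_le_max h1 (h2.trans ?_)
      gcongr
      exact norm_radialRetraction_le hR0 _)
    (sub_nonneg.2 htf.2) (χ tf, p tf)
  obtain ⟨hz₁, hz₁F⟩ := isPrimitiveOn_of_mem_extremalTriples htf.1 h
  have hpR := norm_costate_le htf.1 hC hbd h fun t ht => (hχM t ht).le
  have hz₁G : IsInclusionSolution G tf fun t => (χ t, p t) := by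
    refine ⟨_, hz₁, ?_⟩
    filter_upwards [hz₁F, ae_restrict_mem measurableSet_Icc] with t ht htt
    rw [hG]
    simp only [hPid (χ t, p t) (hχM t htt).le ((hpR t htt).trans (hexp t (htt.2.trans htf.2)))]
    exact ht
  set z : ℝ → Vec n × Vec n := fun t => if t ≤ tf then (χ t, p t) else z₂ (t - tf) with hz
  have hzG : IsInclusionSolution G T z := by
    have := hz₁G.concat hz₂ htf.1 (sub_nonneg.2 htf.2) hz₂0
    rwa [add_sub_cancel] at this
  have hzle : ∀ t ≤ tf, z t = (χ t, p t) := fun t ht => by simp [hz, ht]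
  have hz0 : z 0 = (χi, p 0) := by rw [hzle 0 htf.1, hχ0]
  obtain ⟨v, hv, hvG⟩ := hzG
  have hT : 0 ≤ T := htf.1.trans htf.2
  have hzp : ∀ t ∈ Icc 0 T, ‖(z t).2‖ ≤ R := fun t ht => by
    have := (hv.clm_comp (ContinuousLinearMap.snd ℝ (Vec n) (Vec n))).norm_le_mul_exp hC
      (hvG.mono fun τ hτ => ((hGC _ _ hτ).2.trans
        (mul_le_mul_of_nonneg_left (norm_radialRetraction_le_norm hR0 _) hC))) t ht
    simp only [ContinuousLinearMap.coe_snd', hz0] at this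
    exact this.trans (hexp t ht.2)
  -- as long as the state stays in the ball of radius `M`, `z` solves the original inclusion
  have hkey : ∀ s ∈ Icc 0 T, (∀ t ∈ Ico 0 s, ‖(z t).1‖ ≤ M) →
      IsInclusionSolution (fun z => extremalVelocities f Ω z.1 z.2) s z := fun s hs hsM => by
    refine ⟨v, hv.mono hs, ?_⟩
    rw [← restrict_Ico_eq_restrict_Icc]
    have hsub : Ico 0 s ⊆ Icc 0 T := fun t ht => ⟨ht.1, ht.2.le.trans hs.2⟩
    filter_upwards [ae_restrict_of_ae_restrict_of_subset hsub hvG,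
      ae_restrict_mem measurableSet_Ico] with t ht hts
    simpa only [hG, hPid (z t) (hsM t hts) (hzp t (hsub hts))] using ht
  have hzM : ∀ t ∈ Icc 0 T, ‖(z t).1‖ < M := by
    by_contra! hcon
    have hcl : IsClosed {t ∈ Icc 0 T | M ≤ ‖(z t).1‖} := by
      have := hv.continuousOn.fst.norm.preimage_isClosed_of_isClosed isClosed_Icc
        (isClosed_Ici (a := M))
      exact this
    -- the first time at which the bound fails
    obtain ⟨s, ⟨hsT, hsM⟩, hmin⟩ :=
      (isCompact_Icc.of_isClosed_subset hcl fun t ht => ht.1).exists_isLeast hcon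
    have hsol := hkey s hsT fun t ht => by
      by_contra! hlt
      exact absurd (hmin ⟨⟨ht.1, ht.2.le.trans hsT.2⟩, hlt.le⟩) ht.2.not_ge
    obtain ⟨w, hw, -⟩ := exists_control_of_isInclusionSolution hf hΩ hne hsT.1 hsol
    rw [hz0] at hw
    exact absurd (hM s hsT _ w hw s ⟨hsT.1, le_rfl⟩) hsM.not_gt
  obtain ⟨w, hw, hwp, hwmax⟩ := exists_control_of_isInclusionSolution hf hΩ hne hT
    (hkey T ⟨hT, le_rfl⟩ fun t ht => (hzM t ⟨ht.1, ht.2.le⟩).le)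
  rw [hz0] at hw
  obtain ⟨t₀, ht₀, hpt₀⟩ := h.2.2.1
  refine ⟨fun t => (z t).1, ⟨fun t => (z t).2, w, hw, hwp, ⟨t₀, ⟨ht₀.1, ht₀.2.trans htf.2⟩, ?_⟩,
    hwmax⟩, fun t ht => ?_⟩
  · simpa only [hzle t₀ ht₀.2] using hpt₀
  · simp only [hzle t ht.2]

theorem exists_subseq_tendstoUniformlyOn_isExtremal
    (hf : ContDiff ℝ 1 (fun z : Vec n × Vec m => f z.1 z.2)) (hΩ : IsCompact Ω)
    (hbdd : UniformlyBoundedResponses f Ω χi T)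
    (hF : ∀ χ p : Vec n, Convex ℝ (extremalVelocities f Ω χ p)) (htf : tf ∈ Icc 0 T)
    {x : ℕ → ℝ → Vec n} (hx : ∀ k, IsExtremal f Ω χi tf (x k)) :
    ∃ (φ : ℕ → ℕ) (y : ℝ → Vec n), StrictMono φ ∧ IsExtremal f Ω χi tf y ∧
      TendstoUniformlyOn (fun k => x (φ k)) y atTop (Icc 0 tf) := by
  obtain ⟨M, hM⟩ := hbdd
  obtain ⟨C, hC, hbd⟩ := exists_bound_extremalField hf hΩ M
  have h0 : (0 : ℝ) ∈ Icc 0 tf := ⟨le_rfl, htf.1⟩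
  -- normalize the costates to `‖p 0‖ = 1`
  have hnorm : ∀ k, ∃ p u, (x k, p, u) ∈ extremalTriples f Ω χi tf ∧ ‖p 0‖ = 1 := fun k => by
    obtain ⟨p, u, h⟩ := hx k
    have hp0 : p 0 ≠ 0 := fun hp0 => by
      obtain ⟨t, ht, hpt⟩ := h.2.2.1
      have := norm_costate_le htf.1 hC hbd h (fun t ht => (hM tf htf _ u h.1 t ht).le) t ht
      simp only [hp0, norm_zero, zero_mul, norm_le_zero_iff] at this
      exact hpt this
    refine ⟨_, u, smul_mem_extremalTriples (inv_pos.2 (norm_pos_iff.2 hp0)) h, ?_⟩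
    rw [norm_smul, norm_inv, norm_norm, inv_mul_cancel₀ (norm_ne_zero_iff.2 hp0)]
  choose p u h hp1 using hnorm
  have hxM : ∀ k, ∀ t ∈ Icc 0 tf, ‖x k t‖ ≤ M := fun k t ht => (hM tf htf _ _ (h k).1 t ht).le
  have hx0 : ∀ k, x k 0 = χi := fun k => ((isCaratheodorySolution_iff htf.1).1 (h k).1.2).2
  set R : ℝ := Real.exp (C * tf) with hR
  have hpR : ∀ k, ∀ t ∈ Icc 0 tf, ‖p k t‖ ≤ R := fun k t ht => by
    refine (norm_costate_le htf.1 hC hbd (h k) (hxM k) t ht).trans ?_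
    rw [hp1, one_mul, hR]
    gcongr
    exact ht.2
  have hprim := fun k => isPrimitiveOn_of_mem_extremalTriples htf.1 (h k)
  obtain ⟨φ, y, hφ, hy, hlim⟩ := exists_subseq_tendstoUniformlyOn_inclusionSolution
    (G := fun z : Vec n × Vec n => extremalVelocities f Ω z.1 z.2)
    (isUpperSemicontinuousMap_extremalVelocities hf hΩ) (fun z => hF _ _)
    (fun z => isClosed_extremalVelocities hf hΩ _) htf.1 (C := (max C (C * R)).toNNReal)
    (r := max ‖χi‖ 1) (w := fun k t => (x k t, p k t)) (fun k => (hprim k).1)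
    (fun k => by
      filter_upwards [ae_restrict_mem measurableSet_Icc] with t ht
      rw [Real.coe_toNNReal _ (le_max_of_le_left hC), Prod.norm_def]
      obtain ⟨h1, h2⟩ := hbd (x k t) (p k t) (hxM k t ht) (u k t) ((h k).1.1.2 t ht)
      refine max_le_max h1 (h2.trans ?_)
      gcongr
      exact hpR k t ht)
    (fun k => (hprim k).2) (fun ε hε => Eventually.of_forall fun k t _ => by simpa using hε)
    (fun k => by rw [Prod.norm_def, hx0, hp1])
  have hlim0 := hlim.tendsto_at h0
  have hy1 : (y 0).1 = χi :=
    tendsto_nhds_unique hlim0.fst_nhds (by simp [hx0])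
  have hy2 : ‖(y 0).2‖ = 1 :=
    tendsto_nhds_unique hlim0.snd_nhds.norm (by simp [hp1])
  obtain ⟨w, hw, hwp, hwmax⟩ := exists_control_of_isInclusionSolution hf hΩ
    ⟨u 0 0, (h 0).1.1.2 0 h0⟩ htf.1 hy
  rw [hy1] at hw
  refine ⟨φ, fun t => (y t).1, hφ, ⟨fun t => (y t).2, w, hw, hwp, ⟨0, h0, ?_⟩, hwmax⟩, ?_⟩
  · exact norm_ne_zero_iff.1 (by rw [hy2]; exact one_ne_zero)
  · exact uniformContinuous_fst.comp_tendstoUniformlyOn hlim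

theorem isCompact_extremalEndpoints
    (hf : ContDiff ℝ 1 (fun z : Vec n × Vec m => f z.1 z.2)) (hΩ : IsCompact Ω)
    (hbdd : UniformlyBoundedResponses f Ω χi T)
    (hF : ∀ χ p : Vec n, Convex ℝ (extremalVelocities f Ω χ p)) (htf : tf ∈ Icc 0 T) :
    IsCompact (extremalEndpoints f Ω χi tf) := by
  refine IsSeqCompact.isCompact fun e he => ?_
  choose z hz hze using he
  obtain ⟨φ, y, hφ, ⟨p, u, hy⟩, hlim⟩ := exists_subseq_tendstoUniformlyOn_isExtremal hf hΩ hbdd hF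
    htf (x := fun k => (z k).1) fun k => ⟨_, _, hz k⟩
  refine ⟨y tf, ⟨_, hy, rfl⟩, φ, hφ, ?_⟩
  have : e ∘ φ = fun k => (z (φ k)).1 tf := funext fun k => hze (φ k)
  rw [this]
  exact hlim.tendsto_at ⟨htf.1, le_rfl⟩

end Main

end PMP

end

theorem lemma4 {n m : ℕ} (f : PMP.Vec n → PMP.Vec m → PMP.Vec n) (Ω : Set (PMP.Vec m))
    (χi : PMP.Vec n) (T : ℝ)
    (hf : ContDiff ℝ 1 (fun z : PMP.Vec n × PMP.Vec m => f z.1 z.2))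
    (hΩ : IsCompact Ω)
    (hbdd : PMP.UniformlyBoundedResponses f Ω χi T)
    (hV : ∀ χ : PMP.Vec n, Convex ℝ (PMP.velocitySet f Ω χ))
    (hF : ∀ χ p : PMP.Vec n, Convex ℝ (PMP.extremalVelocities f Ω χ p)) :
    ∀ tf ∈ Set.Icc (0 : ℝ) T,
      (∀ χ : ℝ → PMP.Vec n, PMP.IsExtremal f Ω χi tf χ → PMP.IsExtendable f Ω χi T tf χ) ∧
      (∀ x : ℕ → ℝ → PMP.Vec n, (∀ k, PMP.IsExtremal f Ω χi tf (x k)) →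
        ∃ (φ : ℕ → ℕ) (y : ℝ → PMP.Vec n), StrictMono φ ∧ PMP.IsExtremal f Ω χi tf y ∧
          TendstoUniformlyOn (fun k => x (φ k)) y Filter.atTop (Set.Icc 0 tf)) ∧
      IsCompact (PMP.extremalEndpoints f Ω χi tf) := by
  intro tf htf
  exact ⟨fun _ hχ => hχ.isExtendable hf hΩ hbdd hF htf,
    fun _ hx => PMP.exists_subseq_tendstoUniformlyOn_isExtremal hf hΩ hbdd hF htf hx,
    PMP.isCompact_extremalEndpoints hf hΩ hbdd hF htf⟩
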